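/- Let $X$ be an algebraic complex K3 surface. Its second cohomology $H^2(X,\mathbb Z)$ with the cup product is identified, by a marking, with the K3 lattice $\Lambda_{K3}=E_8(-1)^2\oplus U^3$; the Hodge structure is given by the class $\omega\in\Lambda_{K3}\otimes\mathbb C$ of a nonzero holomorphic 2-form ($\omega\cdot\omega=0$, $\omega\cdot\bar\omega>0$), $H^{1,1}(X)$ is the orthogonal complement of $\mathbb C\omega\oplus\mathbb C\bar\omega$, and $NS(X)=H^{1,1}(X)\cap H^2(X,\mathbb Z)$. Let $\Upsilon$ be a negative definite primitive sublattice of $NS(X)$ such that $\Upsilon^{\perp_{NS(X)}}=\mathbb Z L$, where $L\in NS(X)$ and $L^2=2d$ with $d>0$. Let $\Upsilon^\vee=\mathrm{Hom}(\Upsilon,\mathbb Z)$, let the discriminant group $\Upsilon^\vee/\Upsilon$ be isomorphic to $\bigoplus_{j=1}^m(\mathbb Z/h_j\mathbb Z)^{n_j}$ with $h_j,n_j\ge 1$ and $h_j\mid h_{j+1}$ for $1\le j\le m-1$, and put $\mathcal L=\mathbb Z L+\Upsilon\subseteq NS(X)$. Then the sum $\mathcal L=\mathbb Z L\oplus\Upsilon$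 is direct, and: i) if $\gcd(2d,h_j)=1$ for all $j$, then $NS(X)=\mathcal L$; ii) otherwise, either $NS(X)=\mathcal L$, or there is an integer $r>1$ with $r\mid 2d$ and $r\mid h_m$ such that $NS(X)$ is an overlattice of $\mathcal L$ of index $r$, generated by $\mathcal L$ and a class $v=(L/r,\upsilon/r)$ (that is, $rv=L+\upsilon$) not in $\mathcal L$, where $\upsilon\in\Upsilon$, $\upsilon/r\in\Upsilon^\vee$ and $\upsilon^2\equiv-2d \pmod{2r^2}$. -/

import Mathlib

noncomputable section

/-! ### The K3 lattice -/

/-- The hyperbolic plane `U`. -/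
def hyperbolicGram : Matrix (Fin 2) (Fin 2) ℤ := !![0, 1; 1, 0]

/-- Indices of the standard basis of `E₈(-1)² ⊕ U³`. -/
abbrev K3Index : Type := (Fin 8 ⊕ Fin 8) ⊕ (Fin 2 ⊕ (Fin 2 ⊕ Fin 2))

/-- The Gram matrix of `E₈(-1)² ⊕ U³`; `E₈(-1)` is minus the Cartan matrix of type `E₈`. -/
def k3Gram : Matrix K3Index K3Index ℤ :=
  Matrix.fromBlocks
    (Matrix.fromBlocks (-CartanMatrix.E₈) 0 0 (-CartanMatrix.E₈)) 0 0
    (Matrix.fromBlocks hyperbolicGram 0 0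
      (Matrix.fromBlocks hyperbolicGram 0 0 hyperbolicGram))

/-- The underlying group of the K3 lattice `Λ = E₈(-1)² ⊕ U³ ≅ H²(X, ℤ)`. -/
abbrev K3Lattice : Type := K3Index → ℤ

/-- The complexification `Λ ⊗ ℂ ≅ H²(X, ℂ)`; complex conjugation is `star`. -/
abbrev K3LatticeC : Type := K3Index → ℂ

/-- The intersection (cup product) form on `Λ`. -/
def k3Form : LinearMap.BilinForm ℤ K3Lattice := Matrix.toBilin' k3Gram

/-- The `ℂ`-bilinear extension of the intersection form to `Λ ⊗ ℂ`. -/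
def k3FormC : LinearMap.BilinForm ℂ K3LatticeC :=
  Matrix.toBilin' (k3Gram.map (Int.cast : ℤ → ℂ))

/-- The inclusion `Λ → Λ ⊗ ℂ`. -/
def k3Incl : K3Lattice →ₗ[ℤ] K3LatticeC where
  toFun x := fun i => (x i : ℂ)
  map_add' x y := by ext i; simp
  map_smul' a x := by ext i; simp

/-! ### K3 surfaces and their Néron–Severi lattices -/

/-- The second cohomology, with cup product and Hodge decomposition, of a complex K3 surface `X`
with a marking `H²(X, ℤ) ≅ Λ`. It is given by the class `omega` in `H²(X, ℂ) = Λ ⊗ ℂ` of a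
nonzero holomorphic 2-form, subject to the Riemann relations `ω · ω = 0` and `ω · ω̄ > 0`. These
are precisely the points of the period domain of K3 surfaces, and (surjectivity of the period
map) each of them comes from a marked K3 surface. -/
structure MarkedK3Surface where
  omega : K3LatticeC
  omega_sq : k3FormC omega omega = 0
  omega_conj_pos : 0 < (k3FormC omega (star omega)).re

namespace MarkedK3Surface

variable (X : MarkedK3Surface)

/-- `H^{2,0}(X) = ℂ ω`. -/
def H20 : Submodule ℂ K3LatticeC := Submodule.span ℂ {X.omega}

/-- `H^{0,2}(X)`, the complex conjugate of `H^{2,0}(X)`. -/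
def H02 : Submodule ℂ K3LatticeC := Submodule.span ℂ {star X.omega}

/-- `H^{1,1}(X)`, the orthogonal complement of `H^{2,0}(X) ⊕ H^{0,2}(X)` in `H²(X, ℂ)`. -/
def H11 : Submodule ℂ K3LatticeC := k3FormC.orthogonal (X.H20 ⊔ X.H02)

/-- The Néron–Severi group `NS(X) = H^{1,1}(X) ∩ H²(X, ℤ)`. -/
def NS : Submodule ℤ K3Lattice := (X.H11.restrictScalars ℤ).comap k3Incl

/-- The intersection form on `NS(X)`. -/
def form : LinearMap.BilinForm ℤ X.NS := k3Form.restrict X.NS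

end MarkedK3Surface

/-! ### Sublattices -/

/-- The sublattice `S` of `N` is primitive: `N ⧸ S` is torsion-free. -/
def IsPrimitiveSublattice {N : Type*} [AddCommGroup N] (S : Submodule ℤ N) : Prop :=
  ∀ (n : ℤ) (x : N), n ≠ 0 → n • x ∈ S → x ∈ S

/-- The form `b` is negative definite on `S`. -/
def IsNegDefOn {N : Type*} [AddCommGroup N] (b : LinearMap.BilinForm ℤ N)
    (S : Submodule ℤ N) : Prop :=
  ∀ x ∈ S, x ≠ 0 → b x x < 0

/-- The canonical map `S → S^∨ = Hom(S, ℤ)`, `x ↦ b(x, ·)`. -/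
def toDualLattice {N : Type*} [AddCommGroup N] (b : LinearMap.BilinForm ℤ N)
    (S : Submodule ℤ N) : S →ₗ[ℤ] Module.Dual ℤ S :=
  b.restrict S

/-- The discriminant group `S^∨ ⧸ S`. -/
abbrev DiscriminantGroup {N : Type*} [AddCommGroup N] (b : LinearMap.BilinForm ℤ N)
    (S : Submodule ℤ N) : Type _ :=
  Module.Dual ℤ S ⧸ LinearMap.range (toDualLattice b S)

/-- `A ≅ ⨁_{j=1}^m (ℤ/h_jℤ)^{n_j}` with `h_1 ∣ h_2 ∣ ⋯ ∣ h_m` (and positive `h_j`, `n_j`). -/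
def HasInvariantFactors (A : Type*) [AddCommGroup A] {m : ℕ} (h n : Fin m → ℕ) : Prop :=
  (∀ j, 0 < h j) ∧ (∀ j, 0 < n j) ∧ (∀ i j, i ≤ j → h i ∣ h j) ∧
    Nonempty (A ≃+ ((j : Fin m) → Fin (n j) → ZMod (h j)))

end

/-! ### Evenness of integral forms -/

/-! Everything is read off from the functional x ↦ x·L on NS(X). Its kernel is Υ
(`mem_of_apply_eq_zero`), its image is gℤ for some g > 0, and L maps to 2d = gr. Hence NS(X)/(ℤL +
Υ) ≅ gℤ/2dℤ is cyclic of order r, generated by any v with v·L = g, and rv − L lies in the kernel Υ.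
An exponent e of Υ^∨/Υ sends NS(X) into Υ + Υ^⊥ = Υ + ℤL, so r ∣ e; take e = h_m. Squaring rv = L +
υ gives the congruence, as the K3 lattice is even. -/

theorem even_apply_self_of_basis {ι N : Type*} [AddCommGroup N] (b : LinearMap.BilinForm ℤ N)
    (hb : b.IsSymm) (e : Module.Basis ι ℤ N) (he : ∀ i, Even (b (e i) (e i))) (x : N) :
    Even (b x x) := by
  induction e.mem_span x using Submodule.span_induction with
  | zero => simp
  | add x y _ _ hx hy =>
    have h : b (x + y) (x + y) = b x x + b y y + (b x y + b x y) := by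
      have := hb.eq x y
      simp only [map_add, LinearMap.add_apply]
      rw [← this]
      ring
    rw [h]
    exact (hx.add hy).add ⟨_, rfl⟩
  | smul c x _ hx =>
    simp only [map_smul, LinearMap.smul_apply, smul_eq_mul]
    exact (hx.mul_left c).mul_left c
  | mem x hx =>
    obtain ⟨i, rfl⟩ := hx
    exact he i

theorem k3Gram_isSymm : k3Gram.IsSymm := by
  have hE : CartanMatrix.E₈.transpose = CartanMatrix.E₈ := by decide
  have hU : hyperbolicGram.transpose = hyperbolicGram := by decide
  simp [Matrix.IsSymm, k3Gram, Matrix.fromBlocks_transpose, hE, hU]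

theorem even_k3Gram_diag (i : K3Index) : Even (k3Gram i i) := by
  have hU : ∀ j, Even (hyperbolicGram j j) := by decide
  rcases i with (j | j) | (j | j | j) <;> simp [k3Gram, hU]

theorem k3Form_isSymm : k3Form.IsSymm := by
  refine ⟨fun x y => ?_⟩
  simp only [k3Form, Matrix.toBilin'_apply]
  rw [Finset.sum_comm]
  refine Finset.sum_congr rfl fun i _ => Finset.sum_congr rfl fun j _ => ?_
  rw [k3Gram_isSymm.apply]
  ring

theorem even_k3Form_self (x : K3Lattice) : Even (k3Form x x) := by
  refine even_apply_self_of_basis k3Form k3Form_isSymm (Pi.basisFun ℤ K3Index) (fun i => ?_) x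
  simpa [k3Form] using even_k3Gram_diag i

theorem MarkedK3Surface.form_comm (X : MarkedK3Surface) (x y : X.NS) :
    X.form x y = X.form y x :=
  k3Form_isSymm.eq y x |>.symm

theorem MarkedK3Surface.even_form_self (X : MarkedK3Surface) (x : X.NS) : Even (X.form x x) :=
  even_k3Form_self x

/-! ### Overlattices of `ℤL ⊕ S` -/

/-- The last invariant factor annihilates the group. -/
theorem HasInvariantFactors.smul_eq_zero {A : Type*} [AddCommGroup A] {m : ℕ} {h n : Fin m → ℕ}
    (H : HasInvariantFactors A h n) {e : ℕ} (he : ∀ j, h j ∣ e) (a : A) : e • a = 0 := by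
  obtain ⟨-, -, -, ⟨f⟩⟩ := H
  apply f.injective
  rw [map_nsmul, map_zero]
  funext j i
  have : (e : ZMod (h j)) = 0 := (ZMod.natCast_eq_zero_iff _ _).2 (he j)
  simp [nsmul_eq_mul, this]

section Overlattice

variable {N : Type*} [AddCommGroup N] {b : LinearMap.BilinForm ℤ N} {S : Submodule ℤ N} {L : N}

theorem disjoint_span_of_isNegDefOn (hneg : IsNegDefOn b S) (hL : 0 ≤ b L L) :
    Disjoint (Submodule.span ℤ {L}) S := by
  rw [Submodule.disjoint_def]
  intro x hx hxS
  obtain ⟨a, rfl⟩ := Submodule.mem_span_singleton.1 hx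
  by_contra h0
  have := hneg _ hxS h0
  simp only [map_smul, LinearMap.smul_apply, smul_eq_mul] at this
  nlinarith [mul_nonneg (mul_self_nonneg a) hL]

/-- If `e` annihilates `S^∨ ⧸ S`, then `e • N ⊆ S + S^⊥`. -/
theorem exists_smul_sub_mem_orthogonal (hb : ∀ x y, b x y = b y x) {e : ℕ}
    (he : ∀ a : DiscriminantGroup b S, e • a = 0) (x : N) :
    ∃ s ∈ S, (e : ℤ) • x - s ∈ b.orthogonal S := by
  -- Pairing with x defines a class in S^∨/S; as e kills it, e·b(x, ·) is pairing with some s ∈ S.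
  have h := he (Submodule.Quotient.mk ((b x).domRestrict S))
  rw [← Submodule.Quotient.mk_smul, Submodule.Quotient.mk_eq_zero] at h
  obtain ⟨s, hs⟩ := h
  refine ⟨s, s.2, fun t ht => ?_⟩
  have := LinearMap.congr_fun hs ⟨t, ht⟩
  have h1 : b s t = e * b x t := by simpa [toDualLattice] using this
  change b t _ = 0
  rw [hb, map_sub, map_smul, LinearMap.sub_apply, LinearMap.smul_apply, h1]
  simp

/-- An element orthogonal to `L` lies in `S`, when `S` is primitive and `S^⊥ = ℤL`. -/
theorem mem_of_apply_eq_zero (hb : ∀ x y, b x y = b y x) (hprim : IsPrimitiveSublattice S)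
    (hperp : b.orthogonal S = Submodule.span ℤ {L}) (hL : b L L ≠ 0) {e : ℕ} (he0 : e ≠ 0)
    (he : ∀ a : DiscriminantGroup b S, e • a = 0) {x : N} (hx : b x L = 0) : x ∈ S := by
  obtain ⟨s, hs, hxs⟩ := exists_smul_sub_mem_orthogonal hb he x
  rw [hperp] at hxs
  obtain ⟨a, ha⟩ := Submodule.mem_span_singleton.1 hxs
  have hLmem : L ∈ b.orthogonal S := hperp ▸ Submodule.mem_span_singleton_self L
  have hsL : b s L = 0 := hLmem s hs
  -- Pairing aL = ex − s with L gives a·L² = 0, so ex = s ∈ S and primitivity applies.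
  have h1 := congrArg (fun y => b y L) ha
  simp only [map_smul, map_sub, LinearMap.smul_apply, LinearMap.sub_apply, hx, hsL, smul_eq_mul,
    mul_zero, sub_zero] at h1
  have ha0 : a = 0 := (mul_eq_zero.1 h1).resolve_right hL
  rw [ha0, zero_smul, eq_comm, sub_eq_zero] at ha
  exact hprim e x (by exact_mod_cast he0) (ha ▸ hs)

/-- The structure of `N` over `ℤL ⊕ S`: the quotient is cyclic of order `r`, generated by a class
`v` with `r v = L + υ`. -/
theorem exists_overlattice_generator (hb : ∀ x y, b x y = b y x) (hprim : IsPrimitiveSublattice S)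
    (hperp : b.orthogonal S = Submodule.span ℤ {L}) {k : ℕ} (hk : 0 < k) (hL : b L L = k)
    {e : ℕ} (he0 : e ≠ 0) (he : ∀ a : DiscriminantGroup b S, e • a = 0) :
    ∃ r : ℕ, 0 < r ∧ r ∣ k ∧ r ∣ e ∧
      (Submodule.span ℤ {L} ⊔ S).toAddSubgroup.index = r ∧
      ∃ (υ : S) (v : N), (r : ℤ) • v = L + υ ∧
        (Submodule.span ℤ {L} ⊔ S) ⊔ Submodule.span ℤ {v} = ⊤ ∧
        (v ∈ Submodule.span ℤ {L} ⊔ S → r = 1) := by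
  have hmem : ∀ {x : N}, b x L = 0 → x ∈ S :=
    mem_of_apply_eq_zero hb hprim hperp (by rw [hL]; exact_mod_cast hk.ne') he0 he
  have hLmem : L ∈ b.orthogonal S := hperp ▸ Submodule.mem_span_singleton_self L
  have hSL : ∀ s ∈ S, b s L = 0 := fun s hs => hLmem s hs
  -- the divisibility `g` of `L` in `N`
  obtain ⟨g, hg⟩ : ∃ g : ℕ, LinearMap.range (b.flip L) = Submodule.span ℤ {(g : ℤ)} := by
    obtain ⟨c, hc⟩ := (inferInstance : (LinearMap.range (b.flip L)).IsPrincipal).principal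
    exact ⟨c.natAbs, by rw [hc]; exact (Int.span_natAbs c).symm⟩
  have hdvd : ∀ x, (g : ℤ) ∣ b x L := fun x => by
    have : b.flip L x ∈ Submodule.span ℤ {(g : ℤ)} := hg ▸ LinearMap.mem_range_self _ x
    obtain ⟨a, ha⟩ := Submodule.mem_span_singleton.1 this
    exact ⟨a, by rw [mul_comm]; exact ha.symm⟩
  obtain ⟨v, hv⟩ : ∃ v, b v L = g := by
    have : (g : ℤ) ∈ LinearMap.range (b.flip L) := hg ▸ Submodule.mem_span_singleton_self _
    exact this
  obtain ⟨r, hr⟩ : g ∣ k := by exact_mod_cast hL ▸ hdvd L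
  have hr0 : 0 < r := Nat.pos_of_ne_zero (by rintro rfl; omega)
  have hg0 : (g : ℤ) ≠ 0 := by rintro h; simp_all
  have hrv : (r : ℤ) • v - L ∈ S := hmem (by
    rw [map_sub, map_smul, LinearMap.sub_apply, LinearMap.smul_apply, hv, hL, hr]
    push_cast
    simp [mul_comm])
  -- ℤL + S is the preimage of kℤ under pairing with L, because S is the kernel and L² = k.
  have hM : ∀ x, x ∈ Submodule.span ℤ {L} ⊔ S ↔ (k : ℤ) ∣ b x L := fun x => by
    rw [Submodule.mem_sup]
    constructor
    · rintro ⟨y, hy, s, hs, rfl⟩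
      obtain ⟨a, rfl⟩ := Submodule.mem_span_singleton.1 hy
      simp [hSL s hs, hL]
    · rintro ⟨a, ha⟩
      refine ⟨a • L, Submodule.mem_span_singleton.2 ⟨a, rfl⟩, x - a • L, hmem ?_, by abel⟩
      rw [map_sub, map_smul, LinearMap.sub_apply, LinearMap.smul_apply, hL, ha]
      simp [mul_comm]
  have hMv : ∀ a : ℤ, a • v ∈ Submodule.span ℤ {L} ⊔ S ↔ (r : ℤ) ∣ a := fun a => by
    rw [hM, map_smul, LinearMap.smul_apply, hv, hr, smul_eq_mul, mul_comm a]
    push_cast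
    exact mul_dvd_mul_iff_left hg0
  have hex : ∀ x, ∃ a : ℤ, x - a • v ∈ S := fun x => by
    obtain ⟨a, ha⟩ := hdvd x
    refine ⟨a, hmem ?_⟩
    rw [map_sub, map_smul, LinearMap.sub_apply, LinearMap.smul_apply, hv, ha]
    simp [mul_comm]
  refine ⟨r, hr0, ⟨g, by rw [hr, mul_comm]⟩, ?_, ?_, ⟨_, hrv⟩, v, by simp, ?_, fun h => ?_⟩
  · obtain ⟨s, hs, hvs⟩ := exists_smul_sub_mem_orthogonal hb he v
    rw [hperp] at hvs
    have : (e : ℤ) • v ∈ Submodule.span ℤ {L} ⊔ S := by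
      rw [← sub_add_cancel ((e : ℤ) • v) s]
      exact Submodule.add_mem_sup hvs hs
    exact_mod_cast (hMv e).1 this
  · let f : ℤ →+ N ⧸ (Submodule.span ℤ {L} ⊔ S).toAddSubgroup :=
      (QuotientAddGroup.mk' _).comp (zmultiplesHom N v)
    have hf : Function.Surjective f := fun y => by
      obtain ⟨x, rfl⟩ := QuotientAddGroup.mk_surjective y
      obtain ⟨a, ha⟩ := hex x
      refine ⟨a, (QuotientAddGroup.eq).2 ?_⟩
      change -(a • v) + x ∈ Submodule.span ℤ {L} ⊔ S
      rw [neg_add_eq_sub]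
      exact Submodule.mem_sup_right ha
    have hker : f.ker = AddSubgroup.zmultiples (r : ℤ) := by
      ext a
      rw [AddMonoidHom.mem_ker, Int.mem_zmultiples_iff, ← hMv]
      exact QuotientAddGroup.eq_zero_iff _
    rw [AddSubgroup.index,
      Nat.card_congr (QuotientAddGroup.quotientKerEquivOfSurjective f hf).symm.toEquiv, hker]
    exact Int.index_zmultiples r
  · rw [eq_top_iff]
    rintro x -
    obtain ⟨a, ha⟩ := hex x
    rw [← sub_add_cancel x (a • v)]
    exact Submodule.add_mem_sup (Submodule.mem_sup_right ha)
      (Submodule.mem_span_singleton.2 ⟨a, rfl⟩)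
  · rw [← one_smul ℤ v, hMv] at h
    exact Nat.dvd_one.1 (by exact_mod_cast h)

end Overlattice

theorem mainTheorem10 (X : MarkedK3Surface) (Υ : Submodule ℤ X.NS) (L : X.NS) (d : ℕ)
    (hneg : IsNegDefOn X.form Υ) (hprim : IsPrimitiveSublattice Υ)
    (hperp : X.form.orthogonal Υ = Submodule.span ℤ {L})
    (hd : 0 < d) (hL : X.form L L = 2 * (d : ℤ))
    (m : ℕ) (h n : Fin m → ℕ)
    (hdisc : HasInvariantFactors (DiscriminantGroup X.form Υ) h n) :
    -- the sum of `ℤL` and `Υ` inside `NS(X)` is direct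
    Disjoint (Submodule.span ℤ {L}) Υ ∧
    -- i)
    ((∀ j, Nat.gcd (2 * d) (h j) = 1) → Submodule.span ℤ {L} ⊔ Υ = ⊤) ∧
    -- ii)
    ((¬ ∀ j, Nat.gcd (2 * d) (h j) = 1) →
      Submodule.span ℤ {L} ⊔ Υ = ⊤ ∨
      ∃ r : ℕ, 1 < r ∧ r ∣ 2 * d ∧ (∃ hm : 0 < m, r ∣ h ⟨m - 1, by omega⟩) ∧
        -- `NS(X)` is an overlattice of `ℤL ⊕ Υ` of index `r`
        (Submodule.span ℤ {L} ⊔ Υ).toAddSubgroup.index = r ∧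
        -- generated over `ℤL ⊕ Υ` by the class `v = (L/r, υ/r)`
        ∃ (υ : Υ) (v : X.NS),
          (r : ℤ) • v = L + υ ∧
          v ∉ Submodule.span ℤ {L} ⊔ Υ ∧
          (Submodule.span ℤ {L} ⊔ Υ) ⊔ Submodule.span ℤ {v} = ⊤ ∧
          -- `υ/r` lies in the dual lattice of `Υ`
          (∃ φ : Module.Dual ℤ Υ, (r : ℤ) • φ = toDualLattice X.form Υ υ) ∧
          X.form υ υ ≡ -(2 * (d : ℤ)) [ZMOD 2 * (r : ℤ) ^ 2]) := by
  have hb := X.form_comm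
  have hLmem : L ∈ X.form.orthogonal Υ := hperp ▸ Submodule.mem_span_singleton_self L
  -- the exponent of the discriminant group
  obtain ⟨e, he0, hje, hem⟩ : ∃ e : ℕ, e ≠ 0 ∧ (∀ j, h j ∣ e) ∧
      (e = 1 ∨ ∃ hm : 0 < m, e = h ⟨m - 1, by omega⟩) := by
    rcases Nat.eq_zero_or_pos m with rfl | hm
    -- With no invariant factors the discriminant group is trivial, so e = 1 and r = 1.
    · exact ⟨1, one_ne_zero, fun j => j.elim0, Or.inl rfl⟩
    · exact ⟨h ⟨m - 1, by omega⟩, (hdisc.1 _).ne',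
        fun j => hdisc.2.2.1 _ _ (Fin.mk_le_mk.2 (by omega)), Or.inr ⟨hm, rfl⟩⟩
  obtain ⟨r, hr0, hrd, hre, hindex, υ, v, hv, htop, hv1⟩ :=
    exists_overlattice_generator hb hprim hperp (k := 2 * d) (by omega) (by exact_mod_cast hL) he0
      (hdisc.smul_eq_zero hje)
  have hone : r = 1 → Submodule.span ℤ {L} ⊔ Υ = ⊤ := fun h1 => by
    rw [h1, AddSubgroup.index_eq_one] at hindex
    exact Submodule.toAddSubgroup_injective hindex
  refine ⟨disjoint_span_of_isNegDefOn hneg (by rw [hL]; positivity), fun hgcd => ?_, fun _ => ?_⟩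
  · apply hone
    rcases hem with rfl | ⟨hm, rfl⟩
    · exact Nat.dvd_one.1 hre
    · exact Nat.dvd_one.1 (hgcd ⟨m - 1, by omega⟩ ▸ Nat.dvd_gcd hrd hre)
  · by_cases h1 : r = 1
    · exact Or.inl (hone h1)
    refine Or.inr ⟨r, by omega, hrd, ?_, hindex, υ, v, hv, fun hmem => h1 (hv1 hmem), htop,
      -- The functional υ/r is pairing with v, since L is orthogonal to Υ.
      ⟨(X.form v).domRestrict Υ, ?_⟩, ?_⟩
    · rcases hem with rfl | ⟨hm, rfl⟩
      · exact absurd (Nat.dvd_one.1 hre) h1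
      · exact ⟨hm, hre⟩
    · ext t
      have hLt : X.form L t = 0 := by rw [hb]; exact hLmem t t.2
      have := congrArg (fun y => X.form y t) hv
      simpa [toDualLattice, hLt] using this
    · have hυL : X.form υ L = 0 := hLmem υ υ.2
      have hLυ : X.form L υ = 0 := by rw [hb, hυL]
      have hsq := congrArg (fun y => X.form y y) hv
      simp only [map_smul, map_add, LinearMap.smul_apply, LinearMap.add_apply, smul_eq_mul, hL,
        hυL, hLυ] at hsq
      -- With v² = 2c, squaring rv = L + υ reads 2r²c = 2d + υ².
      obtain ⟨c, hc⟩ := X.even_form_self v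
      refine (Int.modEq_iff_dvd.2 ⟨-c, ?_⟩)
      rw [hc] at hsq
      linear_combination hsq
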